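/- **Conventions.** Let $\mathbb P=\{1,2,\dots\}$. For a composition $\alpha=(\alpha_1,\dots,\alpha_k)$ of $n$ put $D(\alpha)=\{\alpha_1,\alpha_1+\alpha_2,\dots,\alpha_1+\cdots+\alpha_{k-1}\}$, $M_\alpha=\sum_{i_1<\cdots<i_k}x_{i_1}^{\alpha_1}\cdots x_{i_k}^{\alpha_k}$ and $L_\alpha=\sum_{\beta}M_\beta$, the sum over all compositions $\beta$ of $n$ with $D(\alpha)\subseteq D(\beta)$ (the fundamental quasi-symmetric function; for the empty composition it is $1$). A power series in $\mathbb Z[[x_1,x_2,\dots]]$ is *$L$-positive* if it is a finite linear combination of the $L_\alpha$ with non-negative integer coefficients. Order the cells $(i,j)\in\mathbb P^2$ ($i$ the row, $j$ the column) coordinatewise, and identify a skew shape $\lambda/\mu$ (partitions $\mu\subseteq\lambda$) with the finite convex set of cells $\{(i,j):\mu_i<j\le\lambda_i\}$. For a finite convex set $Q$ of cells and a cell $s$ write $s<Q$ (resp. $s>Q$) if $s\notin Q$ and $s<t$ (resp. $s>t$) for some $t\in Q$, and $s\sim Q$ if $s\in Q$ or $s$ is incomparable with every element of $Q$. For finite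 convex sets $Q,R$ of cells put $$Q\wedge R=\{s\in R: s<Q\}\cup\{s\in Q: s\sim R\text{ or }s<R\},\qquad Q\vee R=\{s\in Q: s>R\}\cup\{s\in R: s\sim Q\text{ or }s>Q\};$$ these are again finite convex sets of cells. A strict–weak assignment is a family $\mathbf p=(p_i)_{i\in\mathbb Z}$ with $p_i\in\{\text{weak},\text{strict}\}$; write $\overline{\text{weak}}=\text{strict}$ and $\overline{\text{strict}}=\text{weak}$. It labels the covering relation $(i-1,j)\lessdot(i,j)$ by $\overline{p_{j-i+1}}$ and the covering relation $(i,j-1)\lessdot(i,j)$ by $p_{j-i}$. For a finite convex set $Q$ of cells, a wave $\mathbf p$-tableau of shape $Q$ is a map $T:Q\to\mathbb P$ such that for every covering relation $s\lessdot t$ with $s,t\in Q$ one has $T(s)<T(t)$ if its label is strict and $T(s)\le T(t)$ if its label is weak. The wave Schur function of $Q$ is $s^{\mathbf p}_Q=\sum_T\prod_{c\in Q}x_{T(c)}$, the sum over all wave $\mathbf p$-tableaux $T$ of shape $Q$. **Corollary 6.2 (cell transfer for wave Schur functions).** Let $\lambda/\mu$ and $\nu/\rho$ be skew shapes and let $\mathbf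 p$ be any strict–weak assignment. Then the difference $$s^{\mathbf p}_{(\lambda/\mu)\wedge(\nu/\rho)}\;s^{\mathbf p}_{(\lambda/\mu)\vee(\nu/\rho)}-s^{\mathbf p}_{\lambda/\mu}\;s^{\mathbf p}_{\nu/\rho}$$ is $L$-positive. -/

import Mathlib

namespace WaveSchur

/-! ### Quasi-symmetric functions

Formal power series in `x₁, x₂, …` over the integers are elements of `MvPowerSeries ℕ+ ℤ`. -/

/-- The exponent vector of the monomial `∏ s, x_(T s)`, i.e. of `x₁ ^ #T⁻¹(1) * x₂ ^ #T⁻¹(2) * ⋯`. -/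
noncomputable def weight {S : Type*} [Fintype S] (T : S → ℕ+) : ℕ+ →₀ ℕ :=
  ∑ s, Finsupp.single (T s) 1

theorem apply_mem_support_weight {S : Type*} [Fintype S] (T : S → ℕ+) (s : S) :
    T s ∈ (weight T).support := by
  rw [Finsupp.mem_support_iff, weight, Finsupp.finsetSum_apply]
  intro h
  have h1 := (Finset.sum_eq_zero_iff.mp h) s (Finset.mem_univ s)
  simp at h1

/-- Only finitely many maps have a given weight, so that weight generating functions of
sets of maps are well defined. -/
theorem finite_weight_eq {S : Type*} [Fintype S] (d : ℕ+ →₀ ℕ) :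
    {T : S → ℕ+ | weight T = d}.Finite := by
  refine (Set.Finite.pi' (t := fun _ : S => (d.support : Set ℕ+))
    fun _ => d.support.finite_toSet).subset ?_
  rintro T rfl s
  exact apply_mem_support_weight T s

/-- The monomial quasi-symmetric function
`M_α = ∑_{i₁ < ⋯ < i_k} x_{i₁} ^ α₁ * ⋯ * x_{i_k} ^ α_k`, given by its coefficients. -/
noncomputable def M {n : ℕ} (α : Composition n) : MvPowerSeries ℕ+ ℤ := fun d =>
  (Nat.card {i : Fin α.length → ℕ+ //
    StrictMono i ∧ ∑ j, Finsupp.single (i j) (α.blocksFun j) = d} : ℤ)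

/-- The set `D(α) = {α₁, α₁ + α₂, …, α₁ + ⋯ + α_{k-1}}` of proper nonempty partial sums. -/
def D {n : ℕ} (α : Composition n) : Finset ℕ :=
  (Finset.Ico 1 α.length).image α.sizeUpTo

/-- The fundamental quasi-symmetric function `L_α = ∑_β M_β`, over all compositions `β` of `n`
with `D(α) ⊆ D(β)`, i.e. over all refinements of `α`. For `n = 0` this is the series `1`. -/
noncomputable def L {n : ℕ} (α : Composition n) : MvPowerSeries ℕ+ ℤ :=
  ∑ β : Composition n with D α ⊆ D β, M β

/-- `f` is a (finite) non-negative linear combination of fundamental quasi-symmetric functions. -/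
def IsLPositive (f : MvPowerSeries ℕ+ ℤ) : Prop :=
  ∃ c : (Σ n : ℕ, Composition n) →₀ ℕ, f = c.sum fun α m => m • L α.2

/-! ### Cell transfer -/

section CellTransfer

variable {P : Type*} [PartialOrder P]

/-- `s < Q`: the element `s` is not in `Q` and lies below some element of `Q`. -/
def Below (s : P) (Q : Finset P) : Prop := s ∉ Q ∧ ∃ t ∈ Q, s < t

/-- `s > Q`: the element `s` is not in `Q` and lies above some element of `Q`. -/
def Above (s : P) (Q : Finset P) : Prop := s ∉ Q ∧ ∃ t ∈ Q, t < s

/-- `s ∼ Q`: the element `s` is in `Q` or is incomparable with all elements of `Q`. -/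
def Sim (s : P) (Q : Finset P) : Prop := s ∈ Q ∨ ∀ t ∈ Q, ¬ s ≤ t ∧ ¬ t ≤ s

open Classical in
/-- `Q ∧ R = {s ∈ R | s < Q} ∪ {s ∈ Q | s ∼ R or s < R}`. -/
noncomputable def cellMeet (Q R : Finset P) : Finset P :=
  R.filter (fun s => Below s Q) ∪ Q.filter (fun s => Sim s R ∨ Below s R)

open Classical in
/-- `Q ∨ R = {s ∈ Q | s > R} ∪ {s ∈ R | s ∼ Q or s > Q}`. -/
noncomputable def cellJoin (Q R : Finset P) : Finset P :=
  Q.filter (fun s => Above s R) ∪ R.filter (fun s => Sim s Q ∨ Above s Q)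

end CellTransfer

/-! ### Wave Schur functions

Cells are elements `(row, column)` of `ℕ × ℕ` with the product order, numbered from `0` as in
`YoungDiagram`; the content `column - row` is the same as for numbering from `1`. -/

/-- The two labels of an edge. -/
inductive EdgeType where
  | weak
  | strict

/-- Exchange of `weak` and `strict`. -/
def EdgeType.bar : EdgeType → EdgeType
  | weak => strict
  | strict => weak

/-- The edge-labeling `O_p` of the covers `s ⋖ t` in `ℕ × ℕ`, where `t = (i, j)`:
the label is the opposite of `p (j - i + 1)` if `s = (i - 1, j)`,
and it is `p (j - i)` if `s = (i, j - 1)`. -/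
def edgeLabel (p : ℤ → EdgeType) (s t : ℕ × ℕ) : EdgeType :=
  if s.2 = t.2 then (p ((t.2 : ℤ) - (t.1 : ℤ) + 1)).bar else p ((t.2 : ℤ) - (t.1 : ℤ))

/-- The set of cells of the skew shape `lam/mu`. -/
def skewCells (lam mu : YoungDiagram) : Finset (ℕ × ℕ) := lam.cells \ mu.cells

/-- Wave `p`-tableaux on a finite set of cells (in the applications, a convex one). -/
def IsWaveTableau (p : ℤ → EdgeType) (Q : Finset (ℕ × ℕ)) (T : Q → ℕ+) : Prop :=
  ∀ s t : Q, s.1 ⋖ t.1 →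
    match edgeLabel p s.1 t.1 with
    | .strict => T s < T t
    | .weak => T s ≤ T t

/-- The wave Schur function `s^p_Q`, the weight generating function of all wave `p`-tableaux
on `Q`, given by its coefficients. -/
noncomputable def waveSchur (p : ℤ → EdgeType) (Q : Finset (ℕ × ℕ)) : MvPowerSeries ℕ+ ℤ :=
  fun d => (Nat.card {T : Q → ℕ+ // IsWaveTableau p Q T ∧ weight T = d} : ℤ)

end WaveSchur

/-! ### Compositions, their partial sums, and the coefficients of `L α` -/

namespace WaveSchur

/-! The strict–weak labels come from an injective labeling `θ` of the cells (`exists_labeling`). If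
entries are compared by the key (value, `θ`), a wave tableau is exactly a filling whose keys
increase along covers, that is, a (P, θ)-partition (`isWaveTableau_iff`). The statement thus reduces
to cell transfer for convex subsets `Q`, `R` of a labeled poset.

Given valid fillings of `Q` and `R`, exchange them on a set `W`. It must contain `moved Q R`, the
cells that have to change shape. An exchange can create a descent only at an inversion: cells `s ∈
R`, `t ∈ Q` with `s < t`, where the `Q`-entry at `t` has smaller key than the `R`-entry at `s`. So
let `W` consist of all cells joined to `moved Q R` by a chain of inversions. Every further cell of
`W` lies in `Q ∩ R`, so the shapes become exactly the meet and the join, and both new fillings are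
valid (`transfer_valid`). The set `W` can be reconstructed from the result (`transferSet_eq`), so
the transfer is injective; it also preserves weight. The difference therefore counts the pairs on
(meet, join) outside the image.

Validity and membership in the image depend only on the relative order of the entries
(`exists_transfer_eq`). Hence the complement of the image is a disjoint union of order classes, and
each class has some `L α` as its generating function (`isLPositive_sortingClass`). -/

theorem mem_D_iff {n : ℕ} (α : Composition n) (k : ℕ) :
    k ∈ D α ↔ 0 < k ∧ k < n ∧ ∃ b ∈ α.boundaries, (b : ℕ) = k := by
  constructor
  · intro h
    obtain ⟨m, hm, rfl⟩ := Finset.mem_image.mp h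
    obtain ⟨h1, h2⟩ := Finset.mem_Ico.mp hm
    refine ⟨?_, ?_, α.boundary ⟨m, by omega⟩, ?_, rfl⟩
    · have := α.sizeUpTo_strict_mono (i := 0) (by omega)
      have h3 := α.monotone_sizeUpTo h1
      simp only [Composition.sizeUpTo_zero] at this
      simp only [zero_add] at this
      omega
    · have := α.sizeUpTo_strict_mono h2
      have h3 := α.sizeUpTo_le (m + 1)
      omega
    · simp [Composition.boundaries]
  · rintro ⟨h0, hn, b, hb, rfl⟩
    simp only [Composition.boundaries, Finset.mem_map, Finset.mem_univ, true_and] at hb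
    obtain ⟨m, rfl⟩ := hb
    have hv : ((α.boundary m : Fin (n + 1)) : ℕ) = α.sizeUpTo m := rfl
    change ((α.boundary m : Fin (n + 1)) : ℕ) ∈ _
    change 0 < ((α.boundary m : Fin (n + 1)) : ℕ) at h0
    change ((α.boundary m : Fin (n + 1)) : ℕ) < n at hn
    rw [hv] at *
    refine Finset.mem_image.mpr ⟨m, Finset.mem_Ico.mpr ⟨?_, ?_⟩, rfl⟩
    · by_contra hc
      have : (m : ℕ) = 0 := by omega
      rw [this, Composition.sizeUpTo_zero] at h0
      omega
    · by_contra hc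
      have : (m : ℕ) = α.length := by omega
      rw [this, Composition.sizeUpTo_length] at hn
      omega

theorem D_injective {n : ℕ} : Function.Injective (D (n := n)) := by
  intro α β h
  have hb : α.boundaries = β.boundaries := by
    have key : ∀ α β : Composition n, D α = D β → α.boundaries ⊆ β.boundaries := by
      intro α β h b hb
      by_cases h0 : (b : ℕ) = 0
      · have : b = 0 := Fin.ext h0
        exact this ▸ β.toCompositionAsSet.zero_mem
      by_cases hn : (b : ℕ) = n
      · have : b = Fin.last n := Fin.ext hn
        exact this ▸ β.toCompositionAsSet.getLast_mem
      have hm : (b : ℕ) ∈ D α := (mem_D_iff α b).mpr ⟨by omega, by omega, b, hb, rfl⟩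
      rw [h] at hm
      obtain ⟨_, _, c, hc, hcb⟩ := (mem_D_iff β b).mp hm
      exact Fin.ext hcb ▸ hc
    exact Finset.Subset.antisymm (key _ _ h) (key _ _ h.symm)
  apply (compositionEquiv n).injective
  exact CompositionAsSet.ext hb

theorem exists_D_eq {n : ℕ} (X : Finset ℕ) (hX : X ⊆ Finset.Ico 1 n) :
    ∃ α : Composition n, D α = X := by
  let c : CompositionAsSet n :=
    { boundaries := Finset.univ.filter fun b => (b : ℕ) = 0 ∨ (b : ℕ) = n ∨ (b : ℕ) ∈ X
      zero_mem := by simp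
      getLast_mem := by simp }
  refine ⟨c.toComposition, ?_⟩
  ext k
  rw [mem_D_iff, c.toComposition_boundaries]
  simp only [c, Finset.mem_filter, Finset.mem_univ, true_and]
  constructor
  · rintro ⟨h0, hn, b, hb, rfl⟩
    rcases hb with hb | hb | hb
    · omega
    · omega
    · exact hb
  · intro hk
    have := Finset.mem_Ico.mp (hX hk)
    exact ⟨by omega, by omega, ⟨k, by omega⟩, Or.inr (Or.inr hk), rfl⟩

theorem index_lt_index_iff {n : ℕ} (β : Composition n) {k : ℕ} (hk : k + 1 < n) :
    β.index ⟨k, by omega⟩ < β.index ⟨k + 1, hk⟩ ↔ k + 1 ∈ D β := by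
  have a1 := β.sizeUpTo_index_le ⟨k, by omega⟩
  have a2 := β.lt_sizeUpTo_index_succ ⟨k, by omega⟩
  have b1 := β.sizeUpTo_index_le ⟨k + 1, hk⟩
  have b2 := β.lt_sizeUpTo_index_succ ⟨k + 1, hk⟩
  set x := β.index ⟨k, by omega⟩
  set y := β.index ⟨k + 1, hk⟩
  simp only [Fin.val_succ] at a1 a2 b1 b2
  constructor
  · intro h
    have := β.monotone_sizeUpTo (show (x : ℕ) + 1 ≤ y from h)
    exact Finset.mem_image.mpr ⟨y, Finset.mem_Ico.mpr ⟨by omega, y.2⟩, by omega⟩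
  · intro h
    obtain ⟨m, _, hm⟩ := Finset.mem_image.mp h
    by_contra hc
    have hyx : (y : ℕ) ≤ x := not_lt.mp hc
    rcases lt_or_ge (x : ℕ) m with hxm | hxm
    · have := β.monotone_sizeUpTo (show (y : ℕ) + 1 ≤ m by omega)
      omega
    · have := β.monotone_sizeUpTo hxm
      omega

theorem monotone_index {n : ℕ} (β : Composition n) : Monotone β.index := by
  intro j k hjk
  by_contra hc
  have hlt : β.index k < β.index j := not_le.mp hc
  have a := β.sizeUpTo_index_le j
  have b := β.lt_sizeUpTo_index_succ k
  have := β.monotone_sizeUpTo (show (β.index k : ℕ) + 1 ≤ β.index j from hlt)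
  have hjk' : (j : ℕ) ≤ k := hjk
  simp only [Fin.val_succ] at b
  omega

theorem index_surjective {n : ℕ} (β : Composition n) : Function.Surjective β.index := by
  intro i
  exact ⟨β.embedding i ⟨0, β.one_le_blocksFun i⟩, β.index_embedding _ _⟩

/-- A relation between consecutive indices of a finite sequence propagates to all pairs. -/
theorem fin_rel_of_step {n : ℕ} (r : Fin n → Fin n → Prop)
    (htrans : ∀ a b c, r a b → r b c → r a c)
    (hstep : ∀ k (hk : k + 1 < n), r ⟨k, by omega⟩ ⟨k + 1, hk⟩) {i j : Fin n} (hij : i < j) :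
    r i j := by
  obtain ⟨i, hi⟩ := i
  obtain ⟨j, hj⟩ := j
  have hij : i < j := hij
  induction j with
  | zero => omega
  | succ j ih =>
    rcases Nat.lt_succ_iff_lt_or_eq.mp hij with h | h
    · exact htrans _ _ _ (ih (by omega) h h) (hstep j hj)
    · subst h
      exact hstep i hj

/-- If `v i < v j`, then `v` jumps at some consecutive step between them; `w` jumps there too and
never decreases elsewhere. -/
theorem monotone_lt_of_step {n : ℕ} {A B : Type*} [PartialOrder A] [PartialOrder B]
    {v : Fin n → A} {w : Fin n → B} (hv : Monotone v) (hw : Monotone w)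
    (h : ∀ k (hk : k + 1 < n), v ⟨k, by omega⟩ < v ⟨k + 1, hk⟩ → w ⟨k, by omega⟩ < w ⟨k + 1, hk⟩)
    {i j : Fin n} (hij : v i < v j) : w i < w j := by
  have hlt : i < j := by
    by_contra hc
    exact absurd hij (not_lt_of_ge (hv (not_lt.mp hc)))
  refine fin_rel_of_step (fun i j => i ≤ j ∧ (v i < v j → w i < w j)) ?_ ?_ hlt |>.2 hij
  · rintro a b c ⟨hab, h1⟩ ⟨hbc, h2⟩
    refine ⟨hab.trans hbc, fun hac => ?_⟩
    by_cases hv1 : v a < v b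
    · exact (h1 hv1).trans_le (hw hbc)
    · have : v a = v b := by
        by_contra hne
        exact hv1 (lt_of_le_of_ne (hv hab) hne)
      exact (hw hab).trans_lt (h2 (this ▸ hac))
  · intro k hk
    exact ⟨Fin.mk_le_mk.mpr (by omega), h k hk⟩

theorem weight_comp_index {n : ℕ} (β : Composition n) (i : Fin β.length → ℕ+) :
    weight (i ∘ β.index) = ∑ j, Finsupp.single (i j) (β.blocksFun j) := by
  unfold weight
  rw [← β.blocksFinEquiv.sum_comp, Fintype.sum_sigma]
  refine Finset.sum_congr rfl fun j _ => ?_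
  have : ∀ y : Fin (β.blocksFun j),
      Finsupp.single ((i ∘ β.index) (β.blocksFinEquiv ⟨j, y⟩)) 1
        = (Finsupp.single (i j) 1 : ℕ+ →₀ ℕ) := by
    intro y
    have : β.blocksFinEquiv ⟨j, y⟩ = β.embedding j y := rfl
    rw [Function.comp_apply, this, β.index_embedding]
  rw [Finset.sum_congr rfl fun y _ => this y]
  simp

/-- The coefficients of `L α` count weakly increasing words that increase strictly at `D α`. -/
theorem L_apply {n : ℕ} (α : Composition n) (d : ℕ+ →₀ ℕ) :
    L α d = (Nat.card {u : Fin n → ℕ+ // (Monotone u ∧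
      ∀ k (hk : k + 1 < n), k + 1 ∈ D α → u ⟨k, by omega⟩ < u ⟨k + 1, hk⟩) ∧ weight u = d} : ℤ) := by
  classical
  have hL : L α d = ∑ β : Composition n with D α ⊆ D β, M β d := by
    unfold L
    exact Finset.sum_apply d _ _
  have hfin : ∀ β : Composition n, Finite {i : Fin β.length → ℕ+ //
      StrictMono i ∧ ∑ j, Finsupp.single (i j) (β.blocksFun j) = d} := by
    intro β
    have : Finite {u : Fin n → ℕ+ // weight u = d} := (finite_weight_eq d).to_subtype
    refine Finite.of_injective (β := {u : Fin n → ℕ+ // weight u = d})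
      (fun i => ⟨i.1 ∘ β.index, by rw [weight_comp_index]; exact i.2.2⟩) ?_
    intro i i' h
    exact Subtype.ext ((index_surjective β).injective_comp_right (congrArg Subtype.val h))
  rw [hL, Finset.sum_subtype (p := fun β : Composition n => D α ⊆ D β) _ (by simp)]
  unfold M
  rw [← Nat.cast_sum, ← Nat.card_sigma]
  congr 1
  have hstep : ∀ (β : Composition n) (i : Fin β.length → ℕ+), StrictMono i →
      ∀ k (hk : k + 1 < n),
        (i ∘ β.index) ⟨k, by omega⟩ < (i ∘ β.index) ⟨k + 1, hk⟩ ↔ k + 1 ∈ D β := by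
    intro β i hi k hk
    rw [← index_lt_index_iff β hk]
    exact hi.lt_iff_lt
  refine Nat.card_congr (Equiv.ofBijective (fun x => ⟨x.2.1 ∘ x.1.1.index,
    ⟨x.2.2.1.monotone.comp (monotone_index _), fun k hk h =>
      (hstep _ _ x.2.2.1 k hk).mpr (x.1.2 h)⟩, by rw [weight_comp_index]; exact x.2.2.2⟩) ⟨?_, ?_⟩)
  · rintro ⟨⟨β, hβ⟩, ⟨i, hi, hw⟩⟩ ⟨⟨β', hβ'⟩, ⟨i', hi', hw'⟩⟩ h
    have h : i ∘ β.index = i' ∘ β'.index := congrArg Subtype.val h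
    -- The word determines its composition: its ascent positions are exactly `D β`.
    have hD : D β = D β' := by
      ext k
      have aux : ∀ γ : Composition n, k ∈ D γ → 0 < k ∧ k < n := fun γ hk =>
        ⟨((mem_D_iff γ k).mp hk).1, ((mem_D_iff γ k).mp hk).2.1⟩
      by_cases hk : 0 < k ∧ k < n
      · obtain ⟨k, rfl⟩ : ∃ j, k = j + 1 := ⟨k - 1, by omega⟩
        rw [← hstep β i hi k hk.2, ← hstep β' i' hi' k hk.2, h]
      · exact ⟨fun h => absurd (aux _ h) hk, fun h => absurd (aux _ h) hk⟩
    obtain rfl := D_injective hD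
    obtain rfl := (index_surjective β).injective_comp_right h
    rfl
  · rintro ⟨u, ⟨hu, hs⟩, hw⟩
    obtain ⟨β, hβ⟩ := exists_D_eq (n := n) ((Finset.Ico 1 n).filter fun k =>
      ∃ j, ∃ hj : j + 1 < n, j + 1 = k ∧ u ⟨j, by omega⟩ < u ⟨j + 1, hj⟩)
      (Finset.filter_subset _ _)
    have hmem : ∀ k (hk : k + 1 < n), k + 1 ∈ D β ↔ u ⟨k, by omega⟩ < u ⟨k + 1, hk⟩ := by
      intro k hk
      rw [hβ, Finset.mem_filter, Finset.mem_Ico]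
      constructor
      · rintro ⟨_, j, hj, hjk, h⟩
        obtain rfl : j = k := by omega
        exact h
      · intro h
        exact ⟨by omega, k, hk, rfl, h⟩
    -- `u` and `β.index` jump at the same positions, so `u` is constant on the blocks of `β` and
    -- factors through a strictly increasing map.
    have hlt : ∀ a b, β.index a < β.index b → u a < u b := fun a b =>
      monotone_lt_of_step (monotone_index β) hu fun k hk h =>
        (hmem k hk).mp ((index_lt_index_iff β hk).mp h)
    have hlt' : ∀ a b, u a < u b → β.index a < β.index b := fun a b =>
      monotone_lt_of_step hu (monotone_index β) fun k hk h =>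
        (index_lt_index_iff β hk).mpr ((hmem k hk).mpr h)
    let i : Fin β.length → ℕ+ := u ∘ Function.surjInv (index_surjective β)
    have hi : StrictMono i := by
      intro a b hab
      apply hlt
      rwa [Function.surjInv_eq (index_surjective β) a, Function.surjInv_eq (index_surjective β) b]
    have hiu : i ∘ β.index = u := by
      funext k
      have e : β.index (Function.surjInv (index_surjective β) (β.index k)) = β.index k :=
        Function.surjInv_eq _ _
      refine le_antisymm ?_ ?_
      · by_contra hc
        exact (hlt' _ _ (not_le.mp hc)).ne e.symm
      · by_contra hc
        exact (hlt' _ _ (not_le.mp hc)).ne e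
    refine ⟨⟨⟨β, ?_⟩, ⟨i, hi, ?_⟩⟩, Subtype.ext hiu⟩
    · intro k hk
      obtain ⟨h0, hn, -⟩ := (mem_D_iff α k).mp hk
      obtain ⟨k, rfl⟩ : ∃ j, k = j + 1 := ⟨k - 1, by omega⟩
      exact (hmem k hn).mpr (hs k hn hk)
    · rw [← weight_comp_index, hiu, hw]

/-! ### Order classes of fillings and `L`-positivity -/

theorem isLPositive_L {n : ℕ} (α : Composition n) : IsLPositive (L α) :=
  ⟨Finsupp.single ⟨n, α⟩ 1, by simp⟩

theorem isLPositive_zero : IsLPositive 0 := ⟨0, by simp⟩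

theorem IsLPositive.add {f g : MvPowerSeries ℕ+ ℤ} (hf : IsLPositive f) (hg : IsLPositive g) :
    IsLPositive (f + g) := by
  obtain ⟨a, rfl⟩ := hf
  obtain ⟨b, rfl⟩ := hg
  refine ⟨a + b, ?_⟩
  rw [Finsupp.sum_add_index']
  · simp
  · intros; rw [add_smul]

theorem isLPositive_sum {ι : Type*} (s : Finset ι) (f : ι → MvPowerSeries ℕ+ ℤ)
    (h : ∀ i ∈ s, IsLPositive (f i)) : IsLPositive (∑ i ∈ s, f i) :=
  Finset.sum_induction f IsLPositive (fun _ _ => IsLPositive.add) isLPositive_zero h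

/-- Entries are compared first by value, then by label. -/
def key {S Λ : Type*} (l : S → Λ) (T : S → ℕ+) (x : S) : ℕ+ ×ₗ Λ := toLex (T x, l x)

theorem key_injective {S Λ : Type*} {l : S → Λ} (hl : Function.Injective l) (T : S → ℕ+) :
    Function.Injective (key l T) := by
  intro x y h
  exact hl (congrArg (fun z => (ofLex z).2) h)

theorem key_lt_key {S Λ : Type*} [LinearOrder Λ] (l : S → Λ) (T : S → ℕ+) (x y : S) :
    key l T x < key l T y ↔ T x < T y ∨ T x = T y ∧ l x < l y :=
  Prod.Lex.toLex_lt_toLex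

theorem existsUnique_sorting {S Λ : Type*} [Fintype S] [LinearOrder Λ] {l : S → Λ}
    (hl : Function.Injective l) (T : S → ℕ+) :
    ∃! e : Fin (Fintype.card S) ≃ S, StrictMono (key l T ∘ e) := by
  have hk := key_injective hl T
  let : LinearOrder S := LinearOrder.lift' (key l T) hk
  have e := Fintype.orderIsoFinOfCardEq S rfl
  refine ⟨e.toEquiv, fun a b hab => e.strictMono hab, fun e' he' => ?_⟩
  have h : (key l T ∘ e') = key l T ∘ e := by
    refine (StrictMono.range_inj he' (fun a b hab => e.strictMono hab)).mp ?_
    rw [e'.surjective.range_comp]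
    exact (e.surjective.range_comp (key l T)).symm
  ext a
  exact hk (congrFun h a)

/-- Read along `e`, the fillings are weakly increasing words, and a tie between neighbours is
allowed only where the label `l` ascends. They are the words counted by `L α` with `D α` the descent
set of `l ∘ e`. -/
theorem isLPositive_sortingClass {S Λ : Type*} [Fintype S] [LinearOrder Λ] {l : S → Λ}
    (hl : Function.Injective l) {n : ℕ} (e : Fin n ≃ S) :
    IsLPositive (fun d => (Nat.card {T : S → ℕ+ //
      StrictMono (key l T ∘ e) ∧ weight T = d} : ℤ)) := by
  classical
  obtain ⟨α, hα⟩ := exists_D_eq (n := n) ((Finset.Ico 1 n).filter fun k =>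
      ∃ j, ∃ hj : j + 1 < n, j + 1 = k ∧ l (e ⟨j + 1, hj⟩) < l (e ⟨j, by omega⟩))
      (Finset.filter_subset _ _)
  have hmem : ∀ k (hk : k + 1 < n),
      k + 1 ∈ D α ↔ l (e ⟨k + 1, hk⟩) < l (e ⟨k, by omega⟩) := by
    intro k hk
    rw [hα, Finset.mem_filter, Finset.mem_Ico]
    constructor
    · rintro ⟨_, j, hj, hjk, h⟩
      obtain rfl : j = k := by omega
      exact h
    · intro h
      exact ⟨by omega, k, hk, rfl, h⟩
  refine (congrArg IsLPositive ?_).mpr (isLPositive_L α)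
  funext d
  rw [L_apply]
  congr 1
  refine Nat.card_congr (Equiv.subtypeEquiv (e.arrowCongr (Equiv.refl _)).symm fun T => ?_)
  have hT : (e.arrowCongr (Equiv.refl ℕ+)).symm T = T ∘ e := by
    funext a
    simp [Equiv.arrowCongr]
  rw [hT]
  have hw : weight (T ∘ e) = weight T := by
    unfold weight
    exact e.sum_comp fun s => Finsupp.single (T s) 1
  rw [hw]
  refine and_congr_left fun _ => ⟨fun h => ⟨fun a b hab => ?_, fun k hk hD => ?_⟩, fun h => ?_⟩
  · rcases hab.lt_or_eq with hab | rfl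
    · rcases (key_lt_key l T _ _).mp (h hab) with h' | h'
      · exact h'.le
      · exact h'.1.le
    · exact le_rfl
  · rcases (key_lt_key l T _ _).mp (h (show (⟨k, by omega⟩ : Fin n) < ⟨k + 1, hk⟩ from
      Fin.mk_lt_mk.mpr (by omega))) with h' | h'
    · exact h'
    · exact absurd h'.2 (not_lt.mpr ((hmem k hk).mp hD).le)
  · intro a b hab
    refine fin_rel_of_step (fun a b => (key l T ∘ e) a < (key l T ∘ e) b)
      (fun _ _ _ => lt_trans) (fun k hk => ?_) hab
    refine (key_lt_key l T _ _).mpr ?_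
    have hle : T (e ⟨k, by omega⟩) ≤ T (e ⟨k + 1, hk⟩) :=
      h.1 (Fin.mk_le_mk.mpr (by omega))
    rcases hle.lt_or_eq with h' | h'
    · exact Or.inl h'
    · refine Or.inr ⟨h', lt_of_le_of_ne (not_lt.mp fun hc => ?_) fun hc => ?_⟩
      · exact (h.2 k hk ((hmem k hk).mpr hc)).ne h'
      · have := e.injective (hl hc)
        simp at this

/-- A set of fillings that only depends on the relative order of the entries has an `L`-positive
generating function. -/
theorem isLPositive_of_closed {S Λ : Type*} [Fintype S] [LinearOrder Λ] {l : S → Λ}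
    (hl : Function.Injective l) (X : Set (S → ℕ+))
    (hX : ∀ T T' : S → ℕ+, (∀ x y, key l T x < key l T y ↔ key l T' x < key l T' y) →
      T ∈ X → T' ∈ X) :
    IsLPositive (fun d => (Nat.card {T : S → ℕ+ // T ∈ X ∧ weight T = d} : ℤ)) := by
  classical
  have hsum : (fun d => (Nat.card {T : S → ℕ+ // T ∈ X ∧ weight T = d} : ℤ)) =
      ∑ e : Fin (Fintype.card S) ≃ S, (fun d => (Nat.card {T : S → ℕ+ //
        (StrictMono (key l T ∘ e) ∧ T ∈ X) ∧ weight T = d} : ℤ) : MvPowerSeries ℕ+ ℤ) := by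
    funext d
    rw [show (∑ e : Fin (Fintype.card S) ≃ S, (fun d => (Nat.card {T : S → ℕ+ //
        (StrictMono (key l T ∘ e) ∧ T ∈ X) ∧ weight T = d} : ℤ) : MvPowerSeries ℕ+ ℤ)) d = _
        from Finset.sum_apply d _ _]
    have : ∀ e : Fin (Fintype.card S) ≃ S, Finite {T : S → ℕ+ //
        (StrictMono (key l T ∘ e) ∧ T ∈ X) ∧ weight T = d} := fun e =>
      ((finite_weight_eq d).subset fun T hT => hT.2).to_subtype
    rw [← Nat.cast_sum, ← Nat.card_sigma]
    congr 1
    refine Nat.card_congr (Equiv.ofBijective (fun x => ⟨x.2.1, x.2.2.1.2, x.2.2.2⟩) ⟨?_, ?_⟩).symm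
    · rintro ⟨e, T, hT⟩ ⟨e', T', hT'⟩ h
      obtain rfl : T = T' := congrArg Subtype.val h
      obtain rfl := (existsUnique_sorting hl T).unique hT.1.1 hT'.1.1
      rfl
    · rintro ⟨T, hT, hw⟩
      obtain ⟨e, he, -⟩ := existsUnique_sorting hl T
      exact ⟨⟨e, T, ⟨he, hT⟩, hw⟩, rfl⟩
  rw [hsum]
  refine isLPositive_sum _ _ fun e _ => ?_
  -- All fillings sorted by the same `e` have the same relative order, so `X` contains the whole
  -- class or misses it.
  by_cases hne : ∃ T ∈ X, StrictMono (key l T ∘ e)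
  · obtain ⟨T₀, hT₀, h₀⟩ := hne
    refine (congrArg IsLPositive ?_).mpr (isLPositive_sortingClass hl e)
    funext d
    refine congrArg Nat.cast (Nat.card_congr (Equiv.subtypeEquivRight fun T => ?_))
    refine and_congr_left fun _ => and_iff_left_of_imp fun h => ?_
    refine hX T₀ T (fun x y => ?_) hT₀
    have h1 := h₀.lt_iff_lt (a := e.symm x) (b := e.symm y)
    have h2 := h.lt_iff_lt (a := e.symm x) (b := e.symm y)
    simp only [Function.comp_apply, Equiv.apply_symm_apply] at h1 h2
    rw [h1, h2]
  · refine (congrArg IsLPositive ?_).mpr isLPositive_zero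
    funext d
    have : IsEmpty {T : S → ℕ+ // (StrictMono (key l T ∘ e) ∧ T ∈ X) ∧ weight T = d} :=
      ⟨fun T => hne ⟨T.1, T.2.1.2, T.2.1.1⟩⟩
    rw [Nat.card_of_isEmpty]
    rfl

/-! ### Reachability, exchange and restriction of fillings -/

section Fillings

variable {P Λ : Type*}

/-- The elements connected to `A` by the symmetric closure of `E`. -/
def reach (E : P → P → Prop) (A : Set P) : Set P :=
  {u | ∃ a ∈ A, Relation.ReflTransGen (fun x y => E x y ∨ E y x) a u}

theorem reach_step {E : P → P → Prop} {A : Set P} {x y : P} (hx : x ∈ reach E A)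
    (h : E x y ∨ E y x) : y ∈ reach E A := by
  obtain ⟨a, ha, hax⟩ := hx
  exact ⟨a, ha, hax.tail h⟩

/-- An `E'`-walk from `A` cannot cross the boundary of `reach E A`, and inside it the two relations
agree. -/
theorem reach_congr {E E' : P → P → Prop} {A : Set P}
    (h1 : ∀ x ∈ reach E A, ∀ y ∈ reach E A, E x y ↔ E' x y)
    (h2 : ∀ x ∈ reach E A, ∀ y ∉ reach E A, ¬ E' x y ∧ ¬ E' y x) :
    reach E' A = reach E A := by
  apply Set.Subset.antisymm
  · rintro u ⟨a, ha, hau⟩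
    induction hau with
    | refl => exact ⟨a, ha, .refl⟩
    | tail _ hc ih =>
      by_contra hn
      exact hc.elim (h2 _ ih _ hn).1 (h2 _ ih _ hn).2
  · rintro u ⟨a, ha, hau⟩
    have : u ∈ reach E A ∧ u ∈ reach E' A := by
      induction hau with
      | refl => exact ⟨⟨a, ha, .refl⟩, ⟨a, ha, .refl⟩⟩
      | tail _ hc ih =>
        have hy := reach_step ih.1 hc
        refine ⟨hy, reach_step ih.2 (hc.imp (h1 _ ih.1 _ hy).mp (h1 _ hy _ ih.1).mp)⟩
    exact this.2

/-- The two finite sets as a family indexed by `Bool`. -/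
def pairFn {A : Type*} (Q R : A) : Bool → A
  | false => Q
  | true => R

open Classical in
/-- Exchange the two fillings on `W`. -/
noncomputable def swapOn (W : Set P) (F : Bool → P → ℕ+) : Bool → P → ℕ+ :=
  fun b s => F (xor b (decide (s ∈ W))) s

theorem swapOn_of_mem {W : Set P} {F : Bool → P → ℕ+} {b : Bool} {s : P} (h : s ∈ W) :
    swapOn W F b s = F (!b) s := by
  simp [swapOn, h]

theorem swapOn_of_notMem {W : Set P} {F : Bool → P → ℕ+} {b : Bool} {s : P} (h : s ∉ W) :
    swapOn W F b s = F b s := by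
  simp [swapOn, h]

theorem swapOn_swapOn (W : Set P) (F : Bool → P → ℕ+) : swapOn W (swapOn W F) = F := by
  funext b s
  by_cases h : s ∈ W
  · rw [swapOn_of_mem h, swapOn_of_mem h, Bool.not_not]
  · rw [swapOn_of_notMem h, swapOn_of_notMem h]

theorem key_swapOn_of_mem (θ : P → Λ) {W : Set P} {F : Bool → P → ℕ+} {b : Bool} {s : P}
    (h : s ∈ W) : key θ (swapOn W F b) s = key θ (F (!b)) s := by
  rw [key, key, swapOn_of_mem h]

theorem key_swapOn_of_notMem (θ : P → Λ) {W : Set P} {F : Bool → P → ℕ+} {b : Bool} {s : P}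
    (h : s ∉ W) : key θ (swapOn W F b) s = key θ (F b) s := by
  rw [key, key, swapOn_of_notMem h]

/-- Extension of a pair of fillings by `1`. -/
noncomputable def extend (U : Bool → Finset P) (T : (Σ b, U b) → ℕ+) : Bool → P → ℕ+ := by
  classical
  exact fun b s => if h : s ∈ U b then T ⟨b, s, h⟩ else 1

/-- Restriction of a pair of fillings to a pair of shapes. -/
def restrict (U : Bool → Finset P) (F : Bool → P → ℕ+) (x : Σ b, U b) : ℕ+ := F x.1 x.2

theorem extend_of_mem {U : Bool → Finset P} (T : (Σ b, U b) → ℕ+) {b : Bool} {s : P}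
    (h : s ∈ U b) : extend U T b s = T ⟨b, s, h⟩ := by
  simp [extend, h]

theorem extend_of_notMem {U : Bool → Finset P} (T : (Σ b, U b) → ℕ+) {b : Bool} {s : P}
    (h : s ∉ U b) : extend U T b s = 1 := by
  simp [extend, h]

theorem restrict_extend (U : Bool → Finset P) (T : (Σ b, U b) → ℕ+) :
    restrict U (extend U T) = T := by
  funext ⟨b, s, h⟩
  exact extend_of_mem T h

theorem extend_restrict {U : Bool → Finset P} {F : Bool → P → ℕ+}
    (hF : ∀ b s, s ∉ U b → F b s = 1) : extend U (restrict U F) = F := by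
  funext b s
  by_cases h : s ∈ U b
  · rw [extend_of_mem _ h]
    rfl
  · rw [extend_of_notMem _ h, hF b s h]

theorem weight_restrict (U : Bool → Finset P) (F : Bool → P → ℕ+) :
    weight (restrict U F) = ∑ b, ∑ s ∈ U b, Finsupp.single (F b s) 1 := by
  unfold weight restrict
  rw [Fintype.sum_sigma]
  exact Finset.sum_congr rfl fun b _ => Finset.sum_coe_sort (U b) fun s => Finsupp.single (F b s) 1

end Fillings

/-! ### Cell transfer in a labeled poset -/

section Transfer

variable {P Λ : Type*} [PartialOrder P] [LinearOrder Λ]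

/-- `T` respects the labeling `θ` on the covers inside `Q`. -/
def Valid (θ : P → Λ) (Q : Finset P) (T : P → ℕ+) : Prop :=
  ∀ s ∈ Q, ∀ t ∈ Q, s ⋖ t → key θ T s < key θ T t

/-- By convexity, a saturated chain between two cells of `Q` stays in `Q`, so the conditions on
covers compose. -/
theorem Valid.key_lt [LocallyFiniteOrder P] {θ : P → Λ} {Q : Finset P} {T : P → ℕ+}
    (h : Valid θ Q T) (hQ : (Q : Set P).OrdConnected) {s t : P} (hs : s ∈ Q) (ht : t ∈ Q)
    (hst : s < t) : key θ T s < key θ T t := by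
  have h2 := transGen_covBy_of_lt hst
  have aux : ∀ u, Relation.TransGen (· ⋖ ·) s u → u ≤ t → s < u ∧ key θ T s < key θ T u := by
    intro u hu
    induction hu with
    | single hc =>
      intro hut
      exact ⟨hc.lt, h _ hs _ (hQ.out hs ht ⟨hc.le, hut⟩) hc⟩
    | tail _ hc ih =>
      intro hut
      obtain ⟨h1, h2⟩ := ih (hc.le.trans hut)
      exact ⟨h1.trans hc.lt, h2.trans (h _ (hQ.out hs ht ⟨h1.le, hc.le.trans hut⟩) _
        (hQ.out hs ht ⟨(h1.trans hc.lt).le, hut⟩) hc)⟩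
  exact (aux t h2 le_rfl).2

/-- The cells outside the intersection that change sides under cell transfer. -/
def moved (Q R : Finset P) : Set P := {s | s ∈ R ∧ Below s Q ∨ s ∈ Q ∧ Above s R}

/-- A cell `s` of the shape `b` and a larger cell `t` of the other shape with inverted entries. -/
def edge (θ : P → Λ) (V : Bool → Finset P) (b : Bool) (F : Bool → P → ℕ+) (s t : P) : Prop :=
  s ∈ V b ∧ t ∈ V (!b) ∧ s < t ∧ key θ (F (!b)) t < key θ (F b) s

/-- The set of cells on which cell transfer exchanges the two fillings. -/
def transferSet (θ : P → Λ) (Q R : Finset P) (F : Bool → P → ℕ+) : Set P :=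
  reach (edge θ (pairFn Q R) true F) (moved Q R)

/-- The cell transfer of a pair of fillings. -/
noncomputable def transfer (θ : P → Λ) (Q R : Finset P) (F : Bool → P → ℕ+) : Bool → P → ℕ+ :=
  swapOn (transferSet θ Q R F) F

/-- The two shapes after cell transfer. -/
noncomputable def transferred (Q R : Finset P) : Bool → Finset P :=
  pairFn (cellMeet Q R) (cellJoin Q R)

theorem mem_transferSet_or (θ : P → Λ) {Q R : Finset P} {F : Bool → P → ℕ+} {s : P}
    (h : s ∈ transferSet θ Q R F) : s ∈ moved Q R ∨ (∃ x, edge θ (pairFn Q R) true F x s) ∨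
      ∃ x, edge θ (pairFn Q R) true F s x := by
  obtain ⟨a, ha, h⟩ := h
  rcases Relation.ReflTransGen.cases_tail h with rfl | ⟨x, -, h | h⟩
  · exact Or.inl ha
  · exact Or.inr (Or.inl ⟨x, h⟩)
  · exact Or.inr (Or.inr ⟨x, h⟩)

theorem moved_subset_transferSet (θ : P → Λ) (Q R : Finset P) (F : Bool → P → ℕ+) :
    moved Q R ⊆ transferSet θ Q R F := fun a ha => ⟨a, ha, .refl⟩

/-- The other end of an inversion at `s` lies in the opposite shape. If `s` misses that shape, this
end witnesses that `s` is below `Q` or above `R`. -/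
theorem mem_moved_of_mem_transferSet {θ : P → Λ} {Q R : Finset P} {F : Bool → P → ℕ+} {s : P}
    (h : s ∈ transferSet θ Q R F) (hn : s ∉ Q ∨ s ∉ R) : s ∈ moved Q R := by
  rcases mem_transferSet_or θ h with h | ⟨x, hx, hs, hlt, -⟩ | ⟨x, hs, hx, hlt, -⟩
  · exact h
  · have hs : s ∈ Q := hs
    exact Or.inr ⟨hs, hn.resolve_left (not_not.mpr hs), x, hx, hlt⟩
  · have hs : s ∈ R := hs
    exact Or.inl ⟨hs, hn.resolve_right (not_not.mpr hs), x, hx, hlt⟩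

/-- A common cell is not moved, so it is an end of an inversion. Combining that inversion with
monotonicity inside `R` or inside `Q` compares the two entries at `s`. This handles the covers where
no inversion is available to enlarge the exchanged set. -/
theorem key_lt_of_mem_transferSet [LocallyFiniteOrder P] {θ : P → Λ} {Q R : Finset P}
    (hQ : (Q : Set P).OrdConnected) (hR : (R : Set P).OrdConnected) {F : Bool → P → ℕ+}
    (h0 : Valid θ Q (F false)) (h1 : Valid θ R (F true)) {s : P}
    (h : s ∈ transferSet θ Q R F) (hsQ : s ∈ Q) (hsR : s ∈ R) :
    key θ (F false) s < key θ (F true) s := by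
  rcases mem_transferSet_or θ h with h | ⟨x, hx, -, hlt, hk⟩ | ⟨x, -, hx, hlt, hk⟩
  · rcases h with h | h
    · exact absurd hsQ h.2.1
    · exact absurd hsR h.2.1
  · exact lt_trans hk (h1.key_lt hR hx hsR hlt)
  · exact lt_trans (h0.key_lt hQ hsQ hx hlt) hk

/-- By convexity a cell outside `R` is not both above and below `R`, so the two clauses for cells of
`Q` amount to not being above `R`. -/
theorem mem_cellMeet_iff {Q R : Finset P} (hR : (R : Set P).OrdConnected) (s : P) :
    s ∈ cellMeet Q R ↔ s ∈ R ∧ Below s Q ∨ s ∈ Q ∧ ¬ Above s R := by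
  have hconv : ∀ a ∈ R, ∀ b ∈ R, a ≤ s → s ≤ b → s ∈ R := fun a ha b hb h1 h2 =>
    hR.out ha hb ⟨h1, h2⟩
  simp only [cellMeet, Finset.mem_union, Finset.mem_filter]
  refine or_congr_right (and_congr_right fun hs => ?_)
  by_cases hsR : s ∈ R
  · simp [Sim, Above, hsR]
  simp only [Sim, Below, Above, hsR, not_false_eq_true, true_and, false_or]
  constructor
  · rintro (h | ⟨t, ht, hst⟩) ⟨r, hr, hrs⟩
    · exact (h r hr).2 hrs.le
    · exact hsR (hconv r hr t ht hrs.le hst.le)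
  · intro h
    by_cases hb : ∃ t ∈ R, s < t
    · exact Or.inr hb
    · refine Or.inl fun t ht => ⟨fun hst => ?_, fun hts => ?_⟩
      · exact hb ⟨t, ht, lt_of_le_of_ne hst fun e => hsR (e ▸ ht)⟩
      · exact h ⟨t, ht, lt_of_le_of_ne hts fun e => hsR (e ▸ ht)⟩

theorem mem_cellJoin_iff {Q R : Finset P} (hQ : (Q : Set P).OrdConnected) (s : P) :
    s ∈ cellJoin Q R ↔ s ∈ Q ∧ Above s R ∨ s ∈ R ∧ ¬ Below s Q := by
  have hconv : ∀ a ∈ Q, ∀ b ∈ Q, a ≤ s → s ≤ b → s ∈ Q := fun a ha b hb h1 h2 =>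
    hQ.out ha hb ⟨h1, h2⟩
  simp only [cellJoin, Finset.mem_union, Finset.mem_filter]
  refine or_congr_right (and_congr_right fun hs => ?_)
  by_cases hsQ : s ∈ Q
  · simp [Sim, Below, hsQ]
  simp only [Sim, Below, Above, hsQ, not_false_eq_true, true_and, false_or]
  constructor
  · rintro (h | ⟨t, ht, hst⟩) ⟨r, hr, hrs⟩
    · exact (h r hr).1 hrs.le
    · exact hsQ (hconv t ht r hr hst.le hrs.le)
  · intro h
    by_cases hb : ∃ t ∈ Q, t < s
    · exact Or.inr hb
    · refine Or.inl fun t ht => ⟨fun hst => ?_, fun hts => ?_⟩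
      · exact h ⟨t, ht, lt_of_le_of_ne hst fun e => hsQ (e ▸ ht)⟩
      · exact hb ⟨t, ht, lt_of_le_of_ne hts fun e => hsQ (e ▸ ht)⟩

theorem mem_transferred_of_mem {θ : P → Λ} {Q R : Finset P}
    (hQ : (Q : Set P).OrdConnected) (hR : (R : Set P).OrdConnected) {F : Bool → P → ℕ+} {s : P}
    (h : s ∈ transferSet θ Q R F) (b : Bool) :
    s ∈ transferred Q R b ↔ s ∈ pairFn Q R (!b) := by
  have hm := fun hn => mem_moved_of_mem_transferSet h hn
  simp only [moved, Below, Above, Set.mem_ofPred_eq] at hm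
  cases b
  · change s ∈ cellMeet Q R ↔ s ∈ R
    rw [mem_cellMeet_iff hR]
    simp only [Below, Above]
    by_cases h1 : s ∈ Q <;> by_cases h2 : s ∈ R <;> simp_all
  · change s ∈ cellJoin Q R ↔ s ∈ Q
    rw [mem_cellJoin_iff hQ]
    simp only [Below, Above]
    by_cases h1 : s ∈ Q <;> by_cases h2 : s ∈ R <;> simp_all

theorem mem_transferred_of_notMem {θ : P → Λ} {Q R : Finset P}
    (hQ : (Q : Set P).OrdConnected) (hR : (R : Set P).OrdConnected) {F : Bool → P → ℕ+} {s : P}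
    (h : s ∉ transferSet θ Q R F) (b : Bool) :
    s ∈ transferred Q R b ↔ s ∈ pairFn Q R b := by
  have hm := fun hn => h (moved_subset_transferSet θ Q R F hn)
  simp only [moved, Set.mem_ofPred_eq] at hm
  cases b
  · change s ∈ cellMeet Q R ↔ s ∈ Q
    rw [mem_cellMeet_iff hR]
    tauto
  · change s ∈ cellJoin Q R ↔ s ∈ R
    rw [mem_cellJoin_iff hQ]
    tauto

theorem transfer_valid [LocallyFiniteOrder P] {θ : P → Λ} (hθ : Function.Injective θ)
    {Q R : Finset P} (hQ : (Q : Set P).OrdConnected) (hR : (R : Set P).OrdConnected)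
    {F : Bool → P → ℕ+} (hF : ∀ b, Valid θ (pairFn Q R b) (F b)) (b : Bool) :
    Valid θ (transferred Q R b) (transfer θ Q R F b) := by
  intro s hs t ht hc
  have hst := hc.lt
  have h0 : Valid θ Q (F false) := hF false
  have h1 : Valid θ R (F true) := hF true
  have hF' : ∀ b {s t}, s ∈ pairFn Q R b → t ∈ pairFn Q R b → s < t →
      key θ (F b) s < key θ (F b) t := by
    intro b s t hs ht
    cases b
    · exact h0.key_lt hQ hs ht
    · exact h1.key_lt hR hs ht
  -- Injectivity of `θ` excludes equal keys at distinct cells, so a failed inequality is a genuine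
  -- inversion.
  have hne : key θ (F false) t ≠ key θ (F true) s := fun e =>
    hst.ne' (hθ (congrArg (fun z => (ofLex z).2) e))
  unfold transfer
  by_cases hsW : s ∈ transferSet θ Q R F <;> by_cases htW : t ∈ transferSet θ Q R F
  · rw [mem_transferred_of_mem hQ hR hsW] at hs
    rw [mem_transferred_of_mem hQ hR htW] at ht
    rw [key_swapOn_of_mem θ hsW, key_swapOn_of_mem θ htW]
    exact hF' _ hs ht hst
  · rw [mem_transferred_of_mem hQ hR hsW] at hs
    rw [mem_transferred_of_notMem hQ hR htW] at ht
    rw [key_swapOn_of_mem θ hsW, key_swapOn_of_notMem θ htW]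
    -- In the meet a violation would be an inversion, putting `t` into the exchanged set. In the
    -- join the common-cell comparison applies, and convexity rules out `s ∉ R`.
    cases b
    · by_contra hlt
      exact htW (reach_step hsW (Or.inl ⟨hs, ht, hst, lt_of_le_of_ne (not_lt.mp hlt) hne⟩))
    · have hs : s ∈ Q := hs
      have ht : t ∈ R := ht
      by_cases hsR : s ∈ R
      · exact (key_lt_of_mem_transferSet hQ hR h0 h1 hsW hs hsR).trans
          (h1.key_lt hR hsR ht hst)
      · rcases mem_moved_of_mem_transferSet hsW (Or.inr hsR) with h | ⟨-, -, r, hr, hrs⟩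
        · exact absurd h.1 hsR
        · exact absurd (hR.out hr ht ⟨hrs.le, hst.le⟩) hsR
  · rw [mem_transferred_of_notMem hQ hR hsW] at hs
    rw [mem_transferred_of_mem hQ hR htW] at ht
    rw [key_swapOn_of_notMem θ hsW, key_swapOn_of_mem θ htW]
    cases b
    · have hs : s ∈ Q := hs
      have ht : t ∈ R := ht
      by_cases htQ : t ∈ Q
      · exact (h0.key_lt hQ hs htQ hst).trans
          (key_lt_of_mem_transferSet hQ hR h0 h1 htW htQ ht)
      · rcases mem_moved_of_mem_transferSet htW (Or.inl htQ) with ⟨-, -, q, hq, htq⟩ | h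
        · exact absurd (hQ.out hs hq ⟨hst.le, htq.le⟩) htQ
        · exact absurd h.1 htQ
    · by_contra hlt
      exact hsW (reach_step htW (Or.inr ⟨hs, ht, hst, lt_of_le_of_ne (not_lt.mp hlt) hne⟩))
  · rw [mem_transferred_of_notMem hQ hR hsW] at hs
    rw [mem_transferred_of_notMem hQ hR htW] at ht
    rw [key_swapOn_of_notMem θ hsW, key_swapOn_of_notMem θ htW]
    exact hF' _ hs ht hst

/-- The exchanged set can be read off from the result of the transfer. -/
theorem transferSet_eq [LocallyFiniteOrder P] {θ : P → Λ}
    {Q R : Finset P} (hQ : (Q : Set P).OrdConnected) (hR : (R : Set P).OrdConnected)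
    {F : Bool → P → ℕ+} (hF : ∀ b, Valid θ (pairFn Q R b) (F b)) :
    reach (edge θ (transferred Q R) false (transfer θ Q R F)) (moved Q R) =
      transferSet θ Q R F := by
  have h0 : Valid θ Q (F false) := hF false
  have h1 : Valid θ R (F true) := hF true
  -- Inside the exchanged set the exchange of shapes matches the change from `true` to `false`, so
  -- the inversions are the old ones. An inversion across the boundary would have both entries from
  -- one original filling, against its validity.
  refine reach_congr (fun x hx y hy => ?_) fun x hx y hy => ⟨?_, ?_⟩
  · change x ∈ transferSet θ Q R F at hx
    change y ∈ transferSet θ Q R F at hy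
    unfold edge transfer
    rw [mem_transferred_of_mem hQ hR hx, mem_transferred_of_mem hQ hR hy,
      key_swapOn_of_mem θ hx, key_swapOn_of_mem θ hy]
    rfl
  · change x ∈ transferSet θ Q R F at hx
    change y ∉ transferSet θ Q R F at hy
    unfold edge transfer
    rw [mem_transferred_of_mem hQ hR hx, mem_transferred_of_notMem hQ hR hy,
      key_swapOn_of_mem θ hx, key_swapOn_of_notMem θ hy]
    rintro ⟨a, b, c, d⟩
    exact lt_asymm d (h1.key_lt hR a b c)
  · change x ∈ transferSet θ Q R F at hx
    change y ∉ transferSet θ Q R F at hy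
    unfold edge transfer
    rw [mem_transferred_of_mem hQ hR hx, mem_transferred_of_notMem hQ hR hy,
      key_swapOn_of_mem θ hx, key_swapOn_of_notMem θ hy]
    rintro ⟨a, b, c, d⟩
    exact lt_asymm d (h0.key_lt hQ a b c)

theorem transfer_injOn [LocallyFiniteOrder P] {θ : P → Λ}
    {Q R : Finset P} (hQ : (Q : Set P).OrdConnected) (hR : (R : Set P).OrdConnected)
    {F F' : Bool → P → ℕ+} (hF : ∀ b, Valid θ (pairFn Q R b) (F b))
    (hF' : ∀ b, Valid θ (pairFn Q R b) (F' b)) (h : transfer θ Q R F = transfer θ Q R F') :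
    F = F' := by
  have hW : transferSet θ Q R F = transferSet θ Q R F' := by
    rw [← transferSet_eq hQ hR hF, ← transferSet_eq hQ hR hF', h]
  unfold transfer at h
  rw [hW] at h
  rw [← swapOn_swapOn (transferSet θ Q R F') F, h, swapOn_swapOn]

/-- Entries of different cells compare in the same way in `F` and in `F'`. -/
def SameOrder (θ : P → Λ) (U : Bool → Finset P) (F F' : Bool → P → ℕ+) : Prop :=
  ∀ b c s t, s ∈ U b → t ∈ U c → s ≠ t →
    (key θ (F b) s < key θ (F c) t ↔ key θ (F' b) s < key θ (F' c) t)

theorem SameOrder.valid {θ : P → Λ} {U : Bool → Finset P} {F F' : Bool → P → ℕ+}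
    (h : SameOrder θ U F F') (hF : ∀ b, Valid θ (U b) (F b)) (b : Bool) :
    Valid θ (U b) (F' b) := fun s hs t ht hc =>
  (h b b s t hs ht hc.lt.ne).mp (hF b s hs t ht hc)

theorem SameOrder.edge_eq {θ : P → Λ} {U : Bool → Finset P} {F F' : Bool → P → ℕ+}
    (h : SameOrder θ U F F') (b : Bool) : edge θ U b F' = edge θ U b F := by
  funext s t
  refine propext (and_congr_right fun hs => and_congr_right fun ht => and_congr_right fun hst => ?_)
  exact (h (!b) b t s ht hs hst.ne').symm

/-- The image of the transfer is closed under order-equivalence: undoing the exchange in `G` on the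
set belonging to `F` gives a pair ordered like `F`, hence valid and with the same inversions. -/
theorem exists_transfer_eq {θ : P → Λ}
    {Q R : Finset P} (hQ : (Q : Set P).OrdConnected) (hR : (R : Set P).OrdConnected)
    {F G : Bool → P → ℕ+} (hF : ∀ b, Valid θ (pairFn Q R b) (F b))
    (hG : ∀ b s, s ∉ transferred Q R b → G b s = 1)
    (h : SameOrder θ (transferred Q R) (transfer θ Q R F) G) :
    ∃ F' : Bool → P → ℕ+, (∀ b, Valid θ (pairFn Q R b) (F' b)) ∧
      (∀ b s, s ∉ pairFn Q R b → F' b s = 1) ∧ transfer θ Q R F' = G := by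
  have hmem : ∀ b s, s ∈ pairFn Q R b → ∃ b', s ∈ transferred Q R b' ∧
      (∀ H, key θ (swapOn (transferSet θ Q R F) H b) s = key θ (H b') s) := by
    intro b s hs
    by_cases hW : s ∈ transferSet θ Q R F
    · exact ⟨!b, by rwa [mem_transferred_of_mem hQ hR hW, Bool.not_not],
        fun H => key_swapOn_of_mem θ hW⟩
    · exact ⟨b, by rwa [mem_transferred_of_notMem hQ hR hW], fun H => key_swapOn_of_notMem θ hW⟩
  have hsame : SameOrder θ (pairFn Q R) F (swapOn (transferSet θ Q R F) G) := by
    intro b c s t hs ht hst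
    obtain ⟨b', hs', hb⟩ := hmem b s hs
    obtain ⟨c', ht', hc⟩ := hmem c t ht
    rw [hb, hc, ← h b' c' s t hs' ht' hst, ← hb, ← hc, transfer, swapOn_swapOn]
  refine ⟨swapOn (transferSet θ Q R F) G, hsame.valid hF, fun b s hs => ?_, ?_⟩
  · by_cases hW : s ∈ transferSet θ Q R F
    · rw [swapOn_of_mem hW]
      refine hG _ _ ?_
      rwa [mem_transferred_of_mem hQ hR hW, Bool.not_not]
    · rw [swapOn_of_notMem hW]
      refine hG _ _ ?_
      rwa [mem_transferred_of_notMem hQ hR hW]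
  · unfold transfer
    have : transferSet θ Q R (swapOn (transferSet θ Q R F) G) = transferSet θ Q R F := by
      rw [transferSet, hsame.edge_eq true, transferSet]
    rw [this, swapOn_swapOn]

theorem weight_transfer (θ : P → Λ)
    {Q R : Finset P} (hQ : (Q : Set P).OrdConnected) (hR : (R : Set P).OrdConnected)
    (F : Bool → P → ℕ+) :
    weight (restrict (transferred Q R) (transfer θ Q R F)) = weight (restrict (pairFn Q R) F) := by
  classical
  rw [weight_restrict, weight_restrict]
  let Z : Finset P := (Q ∪ R) ∪ (cellMeet Q R ∪ cellJoin Q R)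
  have hV : ∀ b, pairFn Q R b ⊆ Z := by
    rintro (_ | _) s hs
    · exact Finset.mem_union_left _ (Finset.mem_union_left _ hs)
    · exact Finset.mem_union_left _ (Finset.mem_union_right _ hs)
  have hU : ∀ b, transferred Q R b ⊆ Z := by
    rintro (_ | _) s hs
    · exact Finset.mem_union_right _ (Finset.mem_union_left _ hs)
    · exact Finset.mem_union_right _ (Finset.mem_union_right _ hs)
  have hsum : ∀ (U : Bool → Finset P) (G : Bool → P → ℕ+), (∀ b, U b ⊆ Z) →
      ∑ b, ∑ s ∈ U b, (Finsupp.single (G b s) 1 : ℕ+ →₀ ℕ) =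
      ∑ s ∈ Z, ∑ b, if s ∈ U b then Finsupp.single (G b s) 1 else 0 := by
    intro U G h
    rw [Finset.sum_comm]
    refine Finset.sum_congr rfl fun b _ => ?_
    rw [Finset.sum_ite_mem, Finset.inter_eq_right.mpr (h b)]
  rw [hsum _ _ hU, hsum _ _ hV]
  refine Finset.sum_congr rfl fun s _ => ?_
  unfold transfer
  by_cases hW : s ∈ transferSet θ Q R F
  · simp only [mem_transferred_of_mem hQ hR hW, swapOn_of_mem hW, Fintype.sum_bool, Bool.not_true,
      Bool.not_false]
    rw [add_comm]
  · simp only [mem_transferred_of_notMem hQ hR hW, swapOn_of_notMem hW]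

/-- The pairs of fillings of the two shapes that respect the labeling. -/
def validPairs (θ : P → Λ) (U : Bool → Finset P) : Set ((Σ b, U b) → ℕ+) :=
  {T | ∀ b, Valid θ (U b) (extend U T b)}

/-- Cell transfer for labeled posets. -/
theorem isLPositive_transfer [LocallyFiniteOrder P] {θ : P → Λ} (hθ : Function.Injective θ)
    {Q R : Finset P} (hQ : (Q : Set P).OrdConnected) (hR : (R : Set P).OrdConnected) :
    IsLPositive ((fun d => (Nat.card {T // T ∈ validPairs θ (transferred Q R) ∧
        weight T = d} : ℤ) : MvPowerSeries ℕ+ ℤ) -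
      (fun d => (Nat.card {T // T ∈ validPairs θ (pairFn Q R) ∧ weight T = d} : ℤ) :
        MvPowerSeries ℕ+ ℤ)) := by
  let U := transferred Q R
  let V := pairFn Q R
  let Φ : ((Σ b, V b) → ℕ+) → ((Σ b, U b) → ℕ+) := fun T =>
    restrict U (transfer θ Q R (extend V T))
  have hext : ∀ T, extend U (Φ T) = transfer θ Q R (extend V T) := by
    intro T
    refine extend_restrict fun b s hs => ?_
    unfold transfer
    by_cases hW : s ∈ transferSet θ Q R (extend V T)
    · rw [swapOn_of_mem hW]
      exact extend_of_notMem _ (by rwa [← mem_transferred_of_mem hQ hR hW])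
    · rw [swapOn_of_notMem hW]
      exact extend_of_notMem _ (by rwa [← mem_transferred_of_notMem hQ hR hW])
  have hmaps : ∀ T ∈ validPairs θ V, Φ T ∈ validPairs θ U := by
    intro T hT b
    rw [hext]
    exact transfer_valid hθ hQ hR hT b
  have hinj : Set.InjOn Φ (validPairs θ V) := by
    intro T hT T' hT' h
    have := transfer_injOn hQ hR hT hT' (by rw [← hext, ← hext, h])
    rw [← restrict_extend V T, this, restrict_extend]
  have hweight : ∀ T, weight (Φ T) = weight T := by
    intro T
    rw [weight_transfer θ hQ hR, restrict_extend]
  -- A cell may occur in both shapes, so the shape breaks ties. The Boolean affects only comparisons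
  -- of a cell with itself, which `SameOrder` ignores.
  let l : (Σ b, U b) → Λ ×ₗ Bool := fun x => toLex (θ x.2, x.1)
  have hl : Function.Injective l := by
    rintro ⟨b, s, hs⟩ ⟨c, t, ht⟩ h
    have h1 : s = t := hθ (congrArg (fun z => (ofLex z).1) h)
    have h2 : b = c := congrArg (fun z => (ofLex z).2) h
    subst h1 h2
    rfl
  have hsame : ∀ T T' : (Σ b, U b) → ℕ+,
      (∀ x y, key l T x < key l T y ↔ key l T' x < key l T' y) →
      SameOrder θ U (extend U T) (extend U T') := by
    intro T T' h b c s t hs ht hst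
    have := h ⟨b, s, hs⟩ ⟨c, t, ht⟩
    have hne : θ s ≠ θ t := fun e => hst (hθ e)
    simp only [key_lt_key, l, Prod.Lex.toLex_lt_toLex, hne, false_and, or_false] at this
    simp only [key, Prod.Lex.toLex_lt_toLex, extend_of_mem _ hs, extend_of_mem _ ht]
    exact this
  have hpos := isLPositive_of_closed hl (validPairs θ U \ Φ '' validPairs θ V) (by
    rintro T T' h ⟨hT, hn⟩
    refine ⟨(hsame T T' h).valid hT, ?_⟩
    rintro ⟨T₀, hT₀, rfl⟩
    have hs := hsame _ _ fun x y => (h x y).symm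
    rw [hext] at hs
    obtain ⟨F', hF', hF'1, hF'G⟩ := exists_transfer_eq hQ hR hT₀
      (fun b s hs => extend_of_notMem _ hs) hs
    refine hn ⟨restrict V F', ?_, ?_⟩
    · intro b
      rw [extend_restrict hF'1]
      exact hF' b
    · change restrict U (transfer θ Q R (extend V (restrict V F'))) = T
      rw [extend_restrict hF'1, hF'G, restrict_extend])
  refine (congrArg IsLPositive ?_).mpr hpos
  funext d
  change (Set.ncard {T | T ∈ validPairs θ U ∧ weight T = d} : ℤ) -
    (Set.ncard {T | T ∈ validPairs θ V ∧ weight T = d} : ℤ) =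
    (Set.ncard {T | T ∈ validPairs θ U \ Φ '' validPairs θ V ∧ weight T = d} : ℤ)
  have himg : (Φ '' {T | T ∈ validPairs θ V ∧ weight T = d}).ncard =
      {T | T ∈ validPairs θ V ∧ weight T = d}.ncard :=
    (hinj.mono fun T hT => hT.1).ncard_image
  have hsub : Φ '' {T | T ∈ validPairs θ V ∧ weight T = d} ⊆
      {T | T ∈ validPairs θ U ∧ weight T = d} := by
    rintro _ ⟨T, ⟨hT, hw⟩, rfl⟩
    exact ⟨hmaps T hT, by rw [hweight, hw]⟩
  have hdiff : {T | T ∈ validPairs θ U \ Φ '' validPairs θ V ∧ weight T = d} =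
      {T | T ∈ validPairs θ U ∧ weight T = d} \
        Φ '' {T | T ∈ validPairs θ V ∧ weight T = d} := by
    ext T
    constructor
    · rintro ⟨⟨hT, hn⟩, hw⟩
      exact ⟨⟨hT, hw⟩, fun ⟨T', hT', e⟩ => hn ⟨T', hT'.1, e⟩⟩
    · rintro ⟨⟨hT, hw⟩, hn⟩
      exact ⟨⟨hT, fun ⟨T', hT', e⟩ => hn ⟨T', ⟨hT', by rw [← hweight, e, hw]⟩, e⟩⟩, hw⟩
  have hfin : {T | T ∈ validPairs θ U ∧ weight T = d}.Finite :=
    (finite_weight_eq d).subset fun T hT => hT.2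
  rw [hdiff, ← himg, ← Set.ncard_sdiff_add_ncard_of_subset hsub hfin]
  push_cast
  ring

end Transfer

/-! ### Wave tableaux as labeled-poset fillings -/

theorem exists_potential (ε : ℤ → ℤ) : ∃ a : ℤ → ℤ, ∀ c, a c - a (c - 1) = ε c := by
  refine ⟨fun c => ∑ k ∈ Finset.Ioc 0 c, ε k - ∑ k ∈ Finset.Ioc c 0, ε k, fun c => ?_⟩
  beta_reduce
  rcases lt_or_ge 0 c with hc | hc
  · have h : Finset.Ioc 0 c = insert c (Finset.Ioc 0 (c - 1)) := by
      ext k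
      simp only [Finset.mem_Ioc, Finset.mem_insert]
      omega
    have h' : Finset.Ioc (c - 1) 0 = ∅ := Finset.Ioc_eq_empty (by omega)
    have h'' : Finset.Ioc c 0 = ∅ := Finset.Ioc_eq_empty (by omega)
    rw [h, Finset.sum_insert (by simp), h', h'']
    simp
  · have h : Finset.Ioc (c - 1) 0 = insert c (Finset.Ioc c 0) := by
      ext k
      simp only [Finset.mem_Ioc, Finset.mem_insert]
      omega
    have h' : Finset.Ioc 0 (c - 1) = ∅ := Finset.Ioc_eq_empty (by omega)
    have h'' : Finset.Ioc 0 c = ∅ := Finset.Ioc_eq_empty (by omega)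
    rw [h, Finset.sum_insert (by simp), h', h'']
    simp

/-- The edge labeling `edgeLabel p` comes from a labeling of the cells. -/
theorem exists_labeling (p : ℤ → EdgeType) :
    ∃ θ : ℕ × ℕ → ℤ ×ₗ (ℕ ×ₗ ℕ), Function.Injective θ ∧ ∀ s t : ℕ × ℕ, s ⋖ t →
      (edgeLabel p s t = .strict → θ t < θ s) ∧ (edgeLabel p s t = .weak → θ s < θ t) := by
  obtain ⟨a, ha⟩ := exists_potential fun c => match p c with
    | .weak => 1
    | .strict => -1
  have hw : ∀ c, p c = .weak → a (c - 1) < a c := by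
    intro c hc
    have := ha c
    simp only [hc] at this
    omega
  have hs : ∀ c, p c = .strict → a c < a (c - 1) := by
    intro c hc
    have := ha c
    simp only [hc] at this
    omega
  -- The potential of the content decides every cover; the cell itself is appended only for
  -- injectivity.
  refine ⟨fun s => toLex (a ((s.2 : ℤ) - s.1), toLex s), fun s t h => ?_, ?_⟩
  · exact congrArg (fun z => ofLex (ofLex z).2) h
  rintro ⟨i, j⟩ ⟨i', j'⟩ h
  rcases Prod.mk_covBy_mk_iff.mp h with ⟨hc, rfl⟩ | ⟨hc, rfl⟩
  · obtain rfl : i + 1 = i' := Order.covBy_iff_add_one_eq.mp hc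
    -- A vertical cover lowers the content from `c` to `c - 1` and a horizontal one raises it from
    -- `c - 1` to `c`. Both are governed by `p c`, in opposite directions, which is why the vertical
    -- label carries the bar.
    have e' : (j : ℤ) - ((i + 1 : ℕ) : ℤ) = (j : ℤ) - i - 1 := by push_cast; ring
    simp only [edgeLabel, if_true, Prod.Lex.toLex_lt_toLex, e', sub_add_cancel]
    rcases hp : p ((j : ℤ) - i)
    · exact ⟨fun _ => Or.inl (hw _ hp),
        fun h => nomatch (h : EdgeType.strict = .weak)⟩
    · exact ⟨fun h => (nomatch (h : EdgeType.weak = .strict)), fun _ => Or.inl (hs _ hp)⟩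
  · obtain rfl : j + 1 = j' := Order.covBy_iff_add_one_eq.mp hc
    have e' : (j : ℤ) - i = ((j + 1 : ℕ) : ℤ) - i - 1 := by push_cast; ring
    simp only [edgeLabel, (Nat.lt_succ_self j).ne, if_false, Prod.Lex.toLex_lt_toLex, e']
    rcases hp : p (((j + 1 : ℕ) : ℤ) - i)
    · exact ⟨nofun, fun _ => Or.inl (hw _ hp)⟩
    · exact ⟨fun _ => Or.inl (hs _ hp), nofun⟩

/-- Keys break ties by `θ`: equal values are allowed along a cover exactly when `θ` increases, that
is, on weak edges. -/
theorem isWaveTableau_iff {p : ℤ → EdgeType} {Λ : Type*} [LinearOrder Λ] {θ : ℕ × ℕ → Λ}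
    (hθ : ∀ s t : ℕ × ℕ, s ⋖ t →
      (edgeLabel p s t = .strict → θ t < θ s) ∧ (edgeLabel p s t = .weak → θ s < θ t))
    {Q : Finset (ℕ × ℕ)} {T : Q → ℕ+} {T' : ℕ × ℕ → ℕ+} (hT : ∀ s : Q, T' s = T s) :
    IsWaveTableau p Q T ↔ Valid θ Q T' := by
  have hcov : ∀ s t : Q, s.1 ⋖ t.1 → ((match edgeLabel p s.1 t.1 with
      | .strict => T s < T t
      | .weak => T s ≤ T t) ↔ key θ T' s < key θ T' t) := by
    intro s t hst
    rw [key_lt_key, hT, hT]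
    have h := hθ _ _ hst
    rcases he : edgeLabel p s.1 t.1
    · have := h.2 he
      simp only [this, and_true]
      exact le_iff_lt_or_eq
    · have := h.1 he
      simp only [not_lt.mpr this.le, and_false, or_false]
  exact ⟨fun h s hs t ht hst => (hcov ⟨s, hs⟩ ⟨t, ht⟩ hst).mp (h ⟨s, hs⟩ ⟨t, ht⟩ hst),
    fun h s t hst => (hcov s t hst).mpr (h s.1 s.2 t.1 t.2 hst)⟩

/-- A pair of tableaux is one filling of the disjoint union of the shapes, with weights adding; the
antidiagonal in the product splits the total weight. -/
theorem waveSchur_mul {p : ℤ → EdgeType} {Λ : Type*} [LinearOrder Λ] {θ : ℕ × ℕ → Λ}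
    (hθ : ∀ s t : ℕ × ℕ, s ⋖ t →
      (edgeLabel p s t = .strict → θ t < θ s) ∧ (edgeLabel p s t = .weak → θ s < θ t))
    (Q R : Finset (ℕ × ℕ)) :
    waveSchur p Q * waveSchur p R =
      fun d => (Nat.card {T // T ∈ validPairs θ (pairFn Q R) ∧ weight T = d} : ℤ) := by
  classical
  funext d
  change MvPowerSeries.coeff d (waveSchur p Q * waveSchur p R) = _
  rw [MvPowerSeries.coeff_mul]
  have hfin : ∀ (Q : Finset (ℕ × ℕ)) (d : ℕ+ →₀ ℕ),
      Finite {T : Q → ℕ+ // IsWaveTableau p Q T ∧ weight T = d} := fun Q d =>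
    ((finite_weight_eq d).subset fun T hT => hT.2).to_subtype
  have hterm : ∀ x : (ℕ+ →₀ ℕ) × (ℕ+ →₀ ℕ),
      MvPowerSeries.coeff x.1 (waveSchur p Q) * MvPowerSeries.coeff x.2 (waveSchur p R) =
      (Nat.card ({T : Q → ℕ+ // IsWaveTableau p Q T ∧ weight T = x.1} ×
        {T : R → ℕ+ // IsWaveTableau p R T ∧ weight T = x.2}) : ℤ) := by
    intro x
    rw [Nat.card_prod, Nat.cast_mul]
    rfl
  rw [Finset.sum_congr rfl fun x _ => hterm x, ← Finset.sum_coe_sort, ← Nat.cast_sum,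
    ← Nat.card_sigma]
  congr 1
  have hsplit : ∀ T : (Σ b, ↥(pairFn Q R b)) → ℕ+,
      T ∈ validPairs θ (pairFn Q R) ↔ IsWaveTableau p Q (fun s => T ⟨false, s⟩) ∧
        IsWaveTableau p R (fun s => T ⟨true, s⟩) := by
    intro T
    exact Bool.forall_bool.trans (and_congr
      (isWaveTableau_iff (Q := Q) hθ fun s => extend_of_mem T (b := false) s.2).symm
      (isWaveTableau_iff (Q := R) hθ fun s => extend_of_mem T (b := true) s.2).symm)
  have hweight : ∀ T : (Σ b, ↥(pairFn Q R b)) → ℕ+,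
      weight T = weight (S := Q) (fun s => T ⟨false, s⟩) +
        weight (S := R) (fun s => T ⟨true, s⟩) := by
    intro T
    unfold weight
    rw [Fintype.sum_sigma, Fintype.sum_bool, add_comm]
    rfl
  symm
  refine Nat.card_congr (Equiv.ofBijective (fun T =>
    ⟨⟨(weight (S := Q) (fun s => T.1 ⟨false, s⟩), weight (S := R) (fun s => T.1 ⟨true, s⟩)),
      Finset.HasAntidiagonal.mem_antidiagonal.mpr ((hweight T.1).symm.trans T.2.2)⟩,
      ⟨_, ((hsplit T.1).mp T.2.1).1, rfl⟩, ⟨_, ((hsplit T.1).mp T.2.1).2, rfl⟩⟩) ⟨?_, ?_⟩)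
  · rintro ⟨T, hT⟩ ⟨T', hT'⟩ h
    have h0 : ∀ x y : (Σ x : Finset.HasAntidiagonal.antidiagonal d,
        {T : Q → ℕ+ // IsWaveTableau p Q T ∧ weight T = x.1.1} ×
        {T : R → ℕ+ // IsWaveTableau p R T ∧ weight T = x.1.2}), x = y →
        x.2.1.1 = y.2.1.1 ∧ x.2.2.1 = y.2.2.1 := by
      rintro x _ rfl
      exact ⟨rfl, rfl⟩
    have h1 := h0 _ _ h
    refine Subtype.ext (funext ?_)
    rintro ⟨_ | _, s⟩
    · exact congrFun h1.1 s
    · exact congrFun h1.2 s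
  · rintro ⟨⟨⟨d₁, d₂⟩, hd⟩, ⟨T₁, h₁, e₁⟩, ⟨T₂, h₂, e₂⟩⟩
    have h₁w : weight T₁ = d₁ := e₁
    have h₂w : weight T₂ = d₂ := e₂
    subst h₁w h₂w
    let T : (Σ b, ↥(pairFn Q R b)) → ℕ+ := fun x => match x with
      | ⟨false, s⟩ => T₁ s
      | ⟨true, s⟩ => T₂ s
    exact ⟨⟨T, (hsplit T).mpr ⟨h₁, h₂⟩,
      (hweight T).trans (Finset.HasAntidiagonal.mem_antidiagonal.mp hd)⟩, rfl⟩

theorem ordConnected_skewCells (lam mu : YoungDiagram) :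
    (skewCells lam mu : Set (ℕ × ℕ)).OrdConnected := by
  refine ⟨fun s hs t ht u hu => ?_⟩
  simp only [skewCells, Finset.coe_sdiff, Set.mem_sdiff, Finset.mem_coe] at hs ht ⊢
  exact ⟨lam.isLowerSet hu.2 ht.1, fun h => hs.2 (mu.isLowerSet hu.1 h)⟩

end WaveSchur

theorem corollary6p2 (lam mu nu rho : YoungDiagram) (hmu : mu ≤ lam) (hrho : rho ≤ nu)
    (p : ℤ → WaveSchur.EdgeType) :
    WaveSchur.IsLPositive
      (WaveSchur.waveSchur p (WaveSchur.cellMeet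
          (WaveSchur.skewCells lam mu) (WaveSchur.skewCells nu rho)) *
        WaveSchur.waveSchur p (WaveSchur.cellJoin
          (WaveSchur.skewCells lam mu) (WaveSchur.skewCells nu rho)) -
        WaveSchur.waveSchur p (WaveSchur.skewCells lam mu) *
          WaveSchur.waveSchur p (WaveSchur.skewCells nu rho)) := by
  obtain ⟨θ, hθ, hp⟩ := WaveSchur.exists_labeling p
  rw [WaveSchur.waveSchur_mul hp, WaveSchur.waveSchur_mul hp]
  exact WaveSchur.isLPositive_transfer hθ (WaveSchur.ordConnected_skewCells lam mu)
    (WaveSchur.ordConnected_skewCells nu rho)
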